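/- Let $\mathbb K\in\{\mathbb R,\mathbb C\}$, $L>0$, $\nu>0$, and let $\Omega=(0,1)\times(0,1)\times(0,L)$ be a duct with inlet $\{z=0\}$, outlet $\{z=L\}$ and four lateral walls. Let $\mathbf u_0$ be a real base flow (such as the duct Poiseuille flow $(0,0,w_0(x,y))$): a vector field that is continuous on $\overline\Omega$, $C^1$ with bounded gradient in $\Omega$, satisfies $\nabla\cdot\mathbf u_0=0$ in $\Omega$, and has $\mathbf u_0\cdot\mathbf n\ge 0$ on the outlet. Let $\mathbf V$ be the space of fields $\mathbf u\in H^1(\Omega;\mathbb K^3)$ with zero trace on the inlet and the walls (the closure in $H^1$ of the fields smooth up to the boundary that vanish there). Write $\langle\cdot,\cdot\rangle$ and $\|\cdot\|$ for the $L^2(\Omega)$ product (conjugate-linear in the second argument) and norm, $\|\mathbf u\|_1^2=\|\mathbf u\|^2+\|\nabla\mathbf u\|^2$, and, for $\gamma\in\mathbb R$, $$a(\mathbf u,\mathbf w)+c(\mathbf u,\mathbf w)=\nu\langle\nabla\mathbf u,\nabla\mathbf w\rangle+\langle\mathbf u_0\cdot\nabla\mathbf u,\mathbf w\rangle+\langle\mathbf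 u\cdot\nabla\mathbf u_0,\mathbf w\rangle+\gamma\langle\mathbf u,\mathbf w\rangle .$$ A mesh consists of finitely many nonempty, pairwise disjoint open elements $\Omega^e\subset\Omega$ that cover $\Omega$ up to a null set; $\tilde\Omega=\bigcup_e\Omega^e$, and a subscript $\tilde\Omega$ means that integrals are taken over the elements and summed. A discrete space $\mathbf V_h$ on the mesh is a linear space of fields that are continuous on $\overline\Omega$, polynomial in each element, and zero on the inlet and the walls. Let $h>0$ be the mesh parameter and let $C>0$ be an inverse-estimate constant of $\mathbf V_h$, i.e. $\|\Delta\mathbf v_h\|_{\tilde\Omega}\le Ch^{-1}\|\nabla\mathbf v_h\|$ for all $\mathbf v_h\in\mathbf V_h$. On each element let $|\mathbf u_0|$ be the maximum of the magnitude of $\mathbf u_0$ over the closed element, and set $$\alpha=\frac{h|\mathbf u_0|}{2\nu},\qquad \tau=\frac{h}{2|\mathbf u_0|}\,\zeta(\alpha)$$ (with $\tau=0$ on an element where $\mathbf u_0$ vanishes identically), where $\zeta:(0,\infty)\to[0,\infty)$ satisfies $\sup_{\alpha>0}\zeta(\alpha)/\alpha\le 4/C^2$. The SUPG form is $$\begin{aligned}a_{supg}(\mathbf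 u,\mathbf w)+c_{supg}(\mathbf u,\mathbf w)={}&a(\mathbf u,\mathbf w)+c(\mathbf u,\mathbf w)-\langle\nu\Delta\mathbf u,\tau\mathbf u_0\cdot\nabla\mathbf w\rangle_{\tilde\Omega}+\langle\mathbf u_0\cdot\nabla\mathbf u,\tau\mathbf u_0\cdot\nabla\mathbf w\rangle_{\tilde\Omega}\\&+\langle\mathbf u\cdot\nabla\mathbf u_0,\tau\mathbf u_0\cdot\nabla\mathbf w\rangle_{\tilde\Omega}+\langle\gamma\mathbf u,\tau\mathbf u_0\cdot\nabla\mathbf w\rangle_{\tilde\Omega}.\end{aligned}$$ Then there is $\gamma_0>0$ such that for every $\gamma\ge\gamma_0$: (i) there is $\alpha_1>0$ with $\operatorname{Re}\big(a(\mathbf u,\mathbf u)+c(\mathbf u,\mathbf u)\big)\ge\alpha_1\|\mathbf u\|_1^2$ for all $\mathbf u\in\mathbf V$; and (ii) there are $\delta>0$ and $\alpha_0>0$, independent of the mesh, $\mathbf V_h$, $h$, $C$ and $\zeta$, such that whenever $\tau<\delta$ on every element, $$\operatorname{Re}\big(a_{supg}(\mathbf u_h,\mathbf u_h)+c_{supg}(\mathbf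 u_h,\mathbf u_h)\big)\ge\alpha_0\|\mathbf u_h\|_1^2+\tfrac16\|\tau^{1/2}\mathbf u_0\cdot\nabla\mathbf u_h\|_{\tilde\Omega}^2\qquad\text{for all }\mathbf u_h\in\mathbf V_h .$$ -/

import Mathlib

namespace SUPG

open MeasureTheory Filter Topology
open scoped ContDiff InnerProductSpace

noncomputable section

/-- Physical space with the Euclidean norm; coordinates `0, 1, 2` are `x, y, z`. -/
abbrev Pt : Type := EuclideanSpace ℝ (Fin 3)

/-- Values of a velocity field (`𝕜 = ℝ` or `𝕜 = ℂ`), with the Euclidean / Hermitian norm. -/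
abbrev Vel (𝕜 : Type*) : Type _ := EuclideanSpace 𝕜 (Fin 3)

/-! ### The duct -/

/-- The closed duct `[0,1] × [0,1] × [0,L]`. -/
def closedDuct (L : ℝ) : Set Pt :=
  {x | (0 ≤ x 0 ∧ x 0 ≤ 1) ∧ (0 ≤ x 1 ∧ x 1 ≤ 1) ∧ (0 ≤ x 2 ∧ x 2 ≤ L)}

/-- The open duct `(0,1) × (0,1) × (0,L)`. -/
def openDuct (L : ℝ) : Set Pt :=
  {x | (0 < x 0 ∧ x 0 < 1) ∧ (0 < x 1 ∧ x 1 < 1) ∧ (0 < x 2 ∧ x 2 < L)}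

/-- The part of the boundary with a homogeneous Dirichlet condition: the inlet `z = 0` and the
four walls. -/
def dirichletBdry (L : ℝ) : Set Pt :=
  {x ∈ closedDuct L | x 2 = 0 ∨ x 0 = 0 ∨ x 0 = 1 ∨ x 1 = 0 ∨ x 1 = 1}

/-! ### Differential expressions -/

section Fields

variable {𝕜 : Type*} [RCLike 𝕜]

/-- The partial derivative `∂ₖ u` of a vector field. -/
def pderiv (k : Fin 3) (u : Pt → Vel 𝕜) (x : Pt) : Vel 𝕜 :=
  fderiv ℝ u x (EuclideanSpace.single k (1 : ℝ))

/-- The classical gradient of a vector field, as the family of its partial derivatives. -/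
def grad (u : Pt → Vel 𝕜) : Fin 3 → Pt → Vel 𝕜 := fun k => pderiv k u

/-- The convective derivative `u₀ · ∇u = ∑ₖ u₀ᵏ ∂ₖ u`, where `G k` stands for `∂ₖ u`. -/
def conv (u₀ : Pt → Pt) (G : Fin 3 → Pt → Vel 𝕜) (x : Pt) : Vel 𝕜 :=
  ∑ k, u₀ x k • G k x

/-- The field `u · ∇u₀`, with components `∑ₖ uᵏ ∂ₖ u₀ⁱ`. -/
def convBase (u₀ : Pt → Pt) (u : Pt → Vel 𝕜) (x : Pt) : Vel 𝕜 :=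
  WithLp.toLp 2 fun i => ∑ k, u x k * ((pderiv k u₀ x i : ℝ) : 𝕜)

/-- The `L²` product `⟨f, g⟩ = ∫_S ∑ᵢ fⁱ (gⁱ)^*` over `S`; Mathlib's `inner` is conjugate linear in
its first argument. -/
def ip (S : Set Pt) (f g : Pt → Vel 𝕜) : 𝕜 := ∫ x in S, inner 𝕜 (g x) (f x)

/-- The `L²` product `⟨∇u, ∇w⟩ = ∑ₖ ⟨∂ₖ u, ∂ₖ w⟩` of gradients over `S`. -/
def ipGrad (S : Set Pt) (G H : Fin 3 → Pt → Vel 𝕜) : 𝕜 := ∑ k, ip S (G k) (H k)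

/-- `‖f‖²` in `L²(S)`. -/
def normSq (S : Set Pt) (f : Pt → Vel 𝕜) : ℝ := ∫ x in S, ‖f x‖ ^ 2

/-- `‖∇u‖²` in `L²(S)`. -/
def gradNormSq (S : Set Pt) (G : Fin 3 → Pt → Vel 𝕜) : ℝ := ∑ k, normSq S (G k)

/-- `‖u‖₁²`, the square of the full `H¹` norm on the duct; `G` is the gradient of `u`. -/
def h1NormSq (L : ℝ) (u : Pt → Vel 𝕜) (G : Fin 3 → Pt → Vel 𝕜) : ℝ :=
  normSq (openDuct L) u + gradNormSq (openDuct L) G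

/-- The shifted Galerkin form
`ν⟨∇u, ∇w⟩ + ⟨u₀ · ∇u, w⟩ + ⟨u · ∇u₀, w⟩ + γ⟨u, w⟩`,
for fields `u, w` on the duct with gradients `G, H`. -/
def galerkinForm (L ν γ : ℝ) (u₀ : Pt → Pt) (u : Pt → Vel 𝕜) (G : Fin 3 → Pt → Vel 𝕜)
    (w : Pt → Vel 𝕜) (H : Fin 3 → Pt → Vel 𝕜) : 𝕜 :=
  (ν : 𝕜) * ipGrad (openDuct L) G H + ip (openDuct L) (conv u₀ G) w
    + ip (openDuct L) (convBase u₀ u) w + (γ : 𝕜) * ip (openDuct L) u w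

/-- `u` belongs to the space `V` of `H¹` fields on the duct with zero trace on the inlet and on the
walls, and `G` is its weak gradient: `(u, G)` is an `L²` limit of pairs `(φ, ∇φ)` with `φ` smooth up
to the boundary and zero on the inlet and the walls. -/
def MemV (L : ℝ) (u : Pt → Vel 𝕜) (G : Fin 3 → Pt → Vel 𝕜) : Prop :=
  MemLp u 2 (volume.restrict (openDuct L)) ∧
  (∀ k, MemLp (G k) 2 (volume.restrict (openDuct L))) ∧
  ∃ φ : ℕ → Pt → Vel 𝕜,
    (∀ n, ContDiff ℝ ∞ (φ n)) ∧
    (∀ n, ∀ x ∈ dirichletBdry L, φ n x = 0) ∧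
    Tendsto (fun n => eLpNorm (φ n - u) 2 (volume.restrict (openDuct L))) atTop (𝓝 0) ∧
    ∀ k, Tendsto (fun n => eLpNorm (pderiv k (φ n) - G k) 2 (volume.restrict (openDuct L)))
      atTop (𝓝 0)

end Fields

/-- A base flow in the duct: a (real) field, continuous up to the boundary, continuously
differentiable with bounded gradient inside, divergence free, and with nonnegative normal component
at the outlet `z = L`. The flow `(0, 0, w₀(x, y))` with `w₀` the Poiseuille profile of the square is the
main example. -/
structure IsBaseFlow (L : ℝ) (u₀ : Pt → Pt) : Prop where
  continuousOn : ContinuousOn u₀ (closedDuct L)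
  contDiffOn : ContDiffOn ℝ 1 u₀ (openDuct L)
  grad_bounded : ∃ N : ℝ, ∀ x ∈ openDuct L, ‖fderiv ℝ u₀ x‖ ≤ N
  div_free : ∀ x ∈ openDuct L, ∑ k, pderiv k u₀ x k = 0
  outflow : ∀ x ∈ closedDuct L, x 2 = L → 0 ≤ u₀ x 2

/-! ### Meshes and discrete spaces -/

/-- A mesh of the duct: finitely many nonempty, pairwise disjoint open elements inside the duct
which cover it up to a set of measure zero. -/
structure Mesh (L : ℝ) where
  /-- the number of elements -/
  n : ℕ
  /-- the (open) elements -/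
  elem : Fin n → Set Pt
  isOpen : ∀ e, IsOpen (elem e)
  nonempty : ∀ e, (elem e).Nonempty
  subset : ∀ e, elem e ⊆ openDuct L
  disjoint : Pairwise fun e e' => Disjoint (elem e) (elem e')
  cover : volume (openDuct L \ ⋃ e, elem e) = 0

/-- The space of all continuous piecewise polynomial velocity fields on the duct that vanish on the
inlet and the walls. -/
def pwPoly (𝕜 : Type*) [RCLike 𝕜] {L : ℝ} (T : Mesh L) : Submodule 𝕜 (Pt → Vel 𝕜) where
  carrier := {v | ContinuousOn v (closedDuct L) ∧
    (∀ e, ∃ p : Fin 3 → MvPolynomial (Fin 3) 𝕜, ∀ x ∈ T.elem e, ∀ i,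
      v x i = MvPolynomial.eval (fun j => ((x j : ℝ) : 𝕜)) (p i)) ∧
    ∀ x ∈ dirichletBdry L, v x = 0}
  zero_mem' := ⟨continuousOn_const, fun _ => ⟨0, by simp⟩, by simp⟩
  add_mem' := by
    rintro v w ⟨hv, hpv, hbv⟩ ⟨hw, hpw, hbw⟩
    refine ⟨hv.add hw, fun e => ?_, fun x hx => by simp [hbv x hx, hbw x hx]⟩
    obtain ⟨p, hp⟩ := hpv e
    obtain ⟨q, hq⟩ := hpw e
    exact ⟨p + q, fun x hx i => by simp [hp x hx i, hq x hx i]⟩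
  smul_mem' := by
    rintro c v ⟨hv, hpv, hbv⟩
    refine ⟨hv.const_smul c, fun e => ?_, fun x hx => by simp [hbv x hx]⟩
    obtain ⟨p, hp⟩ := hpv e
    exact ⟨c • p, fun x hx i => by simp [hp x hx i, MvPolynomial.smul_eval]⟩

section Discrete

variable {L : ℝ} (T : Mesh L)

/-- `|u₀|` on the element `e`: the maximum of the magnitude of `u₀` over the closed element. -/
def elemSpeed (u₀ : Pt → Pt) (e : Fin T.n) : ℝ :=
  sSup ((fun x => ‖u₀ x‖) '' closure (T.elem e))

/-- The element Peclet number `α = h |u₀| / (2 ν)`. -/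
def peclet (ν h : ℝ) (u₀ : Pt → Pt) (e : Fin T.n) : ℝ :=
  h * elemSpeed T u₀ e / (2 * ν)

/-- The stabilization parameter `τ = h / (2 |u₀|) ζ(α)` on the element `e` (it is `0` on an element
where `u₀` vanishes identically). -/
def tau (ν h : ℝ) (ζ : ℝ → ℝ) (u₀ : Pt → Pt) (e : Fin T.n) : ℝ :=
  h / (2 * elemSpeed T u₀ e) * ζ (peclet T ν h u₀ e)

variable {𝕜 : Type*} [RCLike 𝕜]

/-- The elementwise product `⟨f, τ g⟩ = ∑ₑ ∫_{Ωᵉ} f · τₑ g^*`, for a parameter `τ` that is constant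
in each element. -/
def ipElem (τ : Fin T.n → ℝ) (f g : Pt → Vel 𝕜) : 𝕜 :=
  ∑ e, ip (T.elem e) f (fun x => τ e • g x)

/-- `‖τ^{1/2} f‖²` in the union of the elements. -/
def tauNormSq (τ : Fin T.n → ℝ) (f : Pt → Vel 𝕜) : ℝ :=
  ∑ e, normSq (T.elem e) (fun x => Real.sqrt (τ e) • f x)

/-- The SUPG form `a_supg(u, w) + c_supg(u, w)`. The Laplacian is taken inside the elements. -/
def supgForm (ν γ : ℝ) (u₀ : Pt → Pt) (τ : Fin T.n → ℝ) (u w : Pt → Vel 𝕜) : 𝕜 :=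
  galerkinForm L ν γ u₀ u (grad u) w (grad w)
    - (ν : 𝕜) * ipElem T τ (Laplacian.laplacian u) (conv u₀ (grad w))
    + ipElem T τ (conv u₀ (grad u)) (conv u₀ (grad w))
    + ipElem T τ (convBase u₀ u) (conv u₀ (grad w))
    + (γ : 𝕜) * ipElem T τ u (conv u₀ (grad w))

/-- `C` is an inverse estimate constant for the discrete space `Vh` with mesh parameter `h`:
`‖Δv‖ ≤ C h⁻¹ ‖∇v‖` for all `v` in `Vh`, with the left norm taken over the open elements. -/
def InverseEstimate (Vh : Submodule 𝕜 (Pt → Vel 𝕜)) (h C : ℝ) : Prop :=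
  ∀ v ∈ Vh, Real.sqrt (∑ e, normSq (T.elem e) (Laplacian.laplacian v)) ≤
    C * h⁻¹ * Real.sqrt (gradNormSq (openDuct L) (grad v))

end Discrete

end

end SUPG

namespace SUPG

open MeasureTheory Filter Topology
open scoped ContDiff InnerProductSpace

/-! ### The duct -/

/-! Everything is absorbed by Young's inequality (`abs_re_ip_le`); there is no integration by parts.
In the Galerkin form, boundedness of `u₀` and of its gradient lets the convective term cost `ν/4
‖∇u‖²` and both first order terms cost a constant multiple of `‖u‖²`, which a large shift `γ` pays
for (`le_re_galerkinForm`).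

In the SUPG form the streamline term is exactly `‖τ^{1/2} u₀·∇u‖²`. The second order term is the
delicate one: the condition on `ζ` gives `τ ≤ h²/(C²ν)` (`tau_le`), which cancels the factor `C²/h²`
of the squared inverse estimate, so that term costs `ν/2 ‖∇u‖²` and half of the streamline term. The
two lower order terms each cost a sixth of it and a multiple of `τ‖u‖²`, small once `τ < δ`
(`le_re_supgForm`). A sixth of the streamline term and `ν/4 ‖∇u‖²` are left, with constants that see
the data only through `ν`, `γ` and the bounds on `u₀`. -/

lemma isCompact_closedDuct (L : ℝ) : IsCompact (closedDuct L) := by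
  have h : closedDuct L = EuclideanSpace.equiv (Fin 3) ℝ ⁻¹'
      Set.Icc (![0, 0, 0] : Fin 3 → ℝ) ![1, 1, L] := by
    ext x
    simp only [closedDuct, Set.mem_ofPred_eq, Set.mem_preimage, Set.mem_Icc, Pi.le_def,
      Fin.forall_fin_succ]
    simp
    tauto
  rw [h]
  exact (EuclideanSpace.equiv (Fin 3) ℝ).toHomeomorph.isClosedEmbedding.isCompact_preimage
    isCompact_Icc

lemma isOpen_openDuct (L : ℝ) : IsOpen (openDuct L) := by
  have h (i : Fin 3) : Continuous fun x : Pt => x i := by fun_prop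
  simp only [openDuct, Set.ofPred_and]
  refine .inter (.inter ?_ ?_) (.inter (.inter ?_ ?_) (.inter ?_ ?_))
  all_goals first
    | exact isOpen_lt continuous_const (h _)
    | exact isOpen_lt (h _) continuous_const

lemma openDuct_subset_closedDuct (L : ℝ) : openDuct L ⊆ closedDuct L :=
  fun _ hx => ⟨⟨hx.1.1.le, hx.1.2.le⟩, ⟨hx.2.1.1.le, hx.2.1.2.le⟩, ⟨hx.2.2.1.le, hx.2.2.2.le⟩⟩

lemma volume_lt_top_of_subset_openDuct {L : ℝ} {S : Set Pt} (hS : S ⊆ openDuct L) :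
    volume S < ⊤ :=
  (measure_mono (hS.trans (openDuct_subset_closedDuct L))).trans_lt
    (isCompact_closedDuct L).measure_lt_top

/-- A field which is continuous on a closed duct is square integrable on its open subsets. -/
lemma memLp_of_continuousOn {E : Type*} [NormedAddCommGroup E] [SecondCountableTopologyEither Pt E]
    {L : ℝ} {S : Set Pt} {f : Pt → E} (hS : S ⊆ openDuct L) (hSo : IsOpen S)
    (hf : ContinuousOn f (closedDuct L)) : MemLp f 2 (volume.restrict S) := by
  have : IsFiniteMeasure (volume.restrict S) :=
    ⟨by simpa using volume_lt_top_of_subset_openDuct hS⟩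
  have hsub := hS.trans (openDuct_subset_closedDuct L)
  obtain ⟨M, hM⟩ := (isCompact_closedDuct L).exists_bound_of_continuousOn hf
  exact .of_bound ((hf.mono hsub).aestronglyMeasurable hSo.measurableSet) M
    ((ae_restrict_mem hSo.measurableSet).mono fun x hx => hM x (hsub hx))

section Fields

variable {𝕜 : Type*} [RCLike 𝕜]

/-! ### The `L²` products -/

lemma normSq_nonneg (S : Set Pt) (f : Pt → Vel 𝕜) : 0 ≤ normSq S f :=
  integral_nonneg fun _ => by positivity

lemma gradNormSq_nonneg (S : Set Pt) (G : Fin 3 → Pt → Vel 𝕜) : 0 ≤ gradNormSq S G :=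
  Finset.sum_nonneg fun _ _ => normSq_nonneg _ _

lemma integrable_inner_of_memLp {S : Set Pt} {f g : Pt → Vel 𝕜}
    (hf : MemLp f 2 (volume.restrict S)) (hg : MemLp g 2 (volume.restrict S)) :
    Integrable (fun x => inner 𝕜 (g x) (f x)) (volume.restrict S) :=
  (hg.norm.integrable_mul hf.norm).mono' (hg.1.inner hf.1)
    (ae_of_all _ fun _ => norm_inner_le_norm _ _)

lemma re_ip {S : Set Pt} {f g : Pt → Vel 𝕜} (hf : MemLp f 2 (volume.restrict S))
    (hg : MemLp g 2 (volume.restrict S)) :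
    RCLike.re (ip S f g) = ∫ x in S, RCLike.re (inner 𝕜 (g x) (f x)) :=
  (integral_re (integrable_inner_of_memLp hf hg)).symm

lemma re_ip_self {S : Set Pt} {f : Pt → Vel 𝕜} (hf : MemLp f 2 (volume.restrict S)) :
    RCLike.re (ip S f f) = normSq S f := by
  rw [re_ip hf hf]
  simp [normSq]

lemma ip_smul_right (S : Set Pt) (f g : Pt → Vel 𝕜) (t : ℝ) :
    ip S f (fun x => t • g x) = (t : 𝕜) * ip S f g := by
  simp only [ip, ← integral_const_mul]
  refine integral_congr_ae (ae_of_all _ fun x => ?_)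
  simp only [RCLike.real_smul_eq_coe_smul (K := 𝕜), inner_smul_left, RCLike.conj_ofReal]

lemma normSq_sqrt_smul (S : Set Pt) (f : Pt → Vel 𝕜) {t : ℝ} (ht : 0 ≤ t) :
    normSq S (fun x => √t • f x) = t * normSq S f := by
  simp only [normSq, ← integral_const_mul, norm_smul, mul_pow, Real.norm_eq_abs, sq_abs,
    Real.sq_sqrt ht]

/-- Young's inequality for the `L²` product. -/
lemma abs_re_ip_le {S : Set Pt} {f g : Pt → Vel 𝕜} (hf : MemLp f 2 (volume.restrict S))
    (hg : MemLp g 2 (volume.restrict S)) {a : ℝ} (ha : 0 < a) :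
    |RCLike.re (ip S f g)| ≤ a / 2 * normSq S f + 1 / (2 * a) * normSq S g := by
  have hfi := hf.integrable_norm_pow (by norm_num)
  have hgi := hg.integrable_norm_pow (by norm_num)
  rw [re_ip hf hg, normSq, normSq, ← integral_const_mul, ← integral_const_mul,
    ← integral_add (hfi.const_mul _) (hgi.const_mul _)]
  refine (abs_integral_le_integral_abs).trans (integral_mono_of_nonneg
    (ae_of_all _ fun _ => abs_nonneg _) ((hfi.const_mul _).add (hgi.const_mul _))
    (ae_of_all _ fun x => ?_))
  have h1 : |RCLike.re (inner 𝕜 (g x) (f x))| ≤ ‖g x‖ * ‖f x‖ :=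
    (RCLike.abs_re_le_norm _).trans (norm_inner_le_norm _ _)
  have h2 : a / 2 * ‖f x‖ ^ 2 + 1 / (2 * a) * ‖g x‖ ^ 2 - ‖g x‖ * ‖f x‖
      = 1 / (2 * a) * (a * ‖f x‖ - ‖g x‖) ^ 2 := by
    field_simp
    ring
  have h3 : 0 ≤ 1 / (2 * a) * (a * ‖f x‖ - ‖g x‖) ^ 2 := by positivity
  simp only
  linarith

/-- A pointwise bound `‖f‖² ≤ B ‖g‖²` carries over to the `L²` norms. -/
lemma normSq_le_of_sq_le {S : Set Pt} (hS : MeasurableSet S) {f g : Pt → Vel 𝕜} {B : ℝ}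
    (hg : MemLp g 2 (volume.restrict S)) (h : ∀ x ∈ S, ‖f x‖ ^ 2 ≤ B * ‖g x‖ ^ 2) :
    normSq S f ≤ B * normSq S g := by
  have hgi := hg.integrable_norm_pow (by norm_num)
  rw [normSq, normSq, ← integral_const_mul]
  exact integral_mono_of_nonneg (ae_of_all _ fun _ => by positivity) (hgi.const_mul _)
    ((ae_restrict_mem hS).mono h)

/-! ### Bounds for the first order terms -/

/-- The factor 3 comes from Cauchy–Schwarz on the sum over three directions. -/
lemma norm_conv_sq_le {u₀ : Pt → Pt} {M : ℝ} {G : Fin 3 → Pt → Vel 𝕜} {x : Pt}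
    (hM : ‖u₀ x‖ ≤ M) : ‖conv u₀ G x‖ ^ 2 ≤ 3 * M ^ 2 * ∑ k, ‖G k x‖ ^ 2 := by
  have h1 : ‖conv u₀ G x‖ ≤ ∑ k, M * ‖G k x‖ := by
    refine (norm_sum_le _ _).trans (Finset.sum_le_sum fun k _ => ?_)
    rw [norm_smul]
    exact mul_le_mul_of_nonneg_right ((PiLp.norm_apply_le _ _).trans hM) (norm_nonneg _)
  calc ‖conv u₀ G x‖ ^ 2 ≤ (∑ k, M * ‖G k x‖) ^ 2 := by gcongr
    _ ≤ (Finset.univ : Finset (Fin 3)).card * ∑ k, (M * ‖G k x‖) ^ 2 := sq_sum_le_card_mul_sum_sq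
    _ = 3 * M ^ 2 * ∑ k, ‖G k x‖ ^ 2 := by
      simp only [mul_pow, ← Finset.mul_sum, Finset.card_univ, Fintype.card_fin]
      push_cast
      ring

lemma memLp_conv {S : Set Pt} (hS : IsOpen S) {u₀ : Pt → Pt} {M : ℝ} (hu₀ : ContinuousOn u₀ S)
    (hM : ∀ x ∈ S, ‖u₀ x‖ ≤ M) {G : Fin 3 → Pt → Vel 𝕜}
    (hG : ∀ k, MemLp (G k) 2 (volume.restrict S)) :
    MemLp (conv u₀ G) 2 (volume.restrict S) := by
  refine memLp_finsetSum (s := Finset.univ) (f := fun k x => u₀ x k • G k x) fun k _ => ?_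
  have hc : ContinuousOn (fun x => u₀ x k) S :=
    (by fun_prop : Continuous fun y : Pt => y k).comp_continuousOn hu₀
  refine (hG k).of_le_mul (c := M)
    ((hc.aestronglyMeasurable hS.measurableSet).smul (hG k).1) ?_
  filter_upwards [ae_restrict_mem hS.measurableSet] with x hx
  rw [norm_smul]
  exact mul_le_mul_of_nonneg_right ((PiLp.norm_apply_le _ _).trans (hM x hx)) (norm_nonneg _)

lemma normSq_conv_le {S : Set Pt} (hS : IsOpen S) {u₀ : Pt → Pt} {M : ℝ}
    (hM : ∀ x ∈ S, ‖u₀ x‖ ≤ M) {G : Fin 3 → Pt → Vel 𝕜}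
    (hG : ∀ k, MemLp (G k) 2 (volume.restrict S)) :
    normSq S (conv u₀ G) ≤ 3 * M ^ 2 * gradNormSq S G := by
  have hGi (k) : Integrable (fun x => ‖G k x‖ ^ 2) (volume.restrict S) := by
    simpa using (hG k).integrable_norm_pow (by norm_num)
  have hsum : gradNormSq S G = ∫ x in S, ∑ k, ‖G k x‖ ^ 2 := by
    rw [integral_finsetSum _ fun k _ => hGi k]
    rfl
  rw [normSq, hsum, ← integral_const_mul]
  exact integral_mono_of_nonneg (ae_of_all _ fun _ => by positivity)
    ((integrable_finsetSum _ fun k _ => hGi k).const_mul _)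
    ((ae_restrict_mem hS.measurableSet).mono fun x hx => norm_conv_sq_le (hM x hx))

lemma norm_pderiv_le (k : Fin 3) (u : Pt → Vel 𝕜) (x : Pt) : ‖pderiv k u x‖ ≤ ‖fderiv ℝ u x‖ := by
  simpa [pderiv] using (fderiv ℝ u x).le_opNorm (EuclideanSpace.single k (1 : ℝ))

/-- Each of the three components is a sum of three terms of size at most `N ‖u x‖`, and 27 = 3 · 3².
-/
lemma norm_convBase_le {u₀ : Pt → Pt} {N : ℝ} {u : Pt → Vel 𝕜} {x : Pt}
    (hN : ‖fderiv ℝ u₀ x‖ ≤ N) : ‖convBase u₀ u x‖ ^ 2 ≤ 27 * N ^ 2 * ‖u x‖ ^ 2 := by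
  have hi (i : Fin 3) : ‖convBase u₀ u x i‖ ≤ 3 * (‖u x‖ * N) := by
    calc ‖convBase u₀ u x i‖ ≤ ∑ k : Fin 3, ‖u x k * ((pderiv k u₀ x i : ℝ) : 𝕜)‖  := by
          change ‖∑ k, u x k * ((pderiv k u₀ x i : ℝ) : 𝕜)‖ ≤ _
          exact norm_sum_le _ _
      _ ≤ ∑ _k : Fin 3, ‖u x‖ * N := by
          refine Finset.sum_le_sum fun k _ => ?_
          rw [norm_mul, RCLike.norm_ofReal, ← Real.norm_eq_abs]
          exact mul_le_mul (PiLp.norm_apply_le _ _)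
            (((PiLp.norm_apply_le _ _).trans (norm_pderiv_le (𝕜 := ℝ) k u₀ x)).trans hN)
            (norm_nonneg _) (norm_nonneg _)
      _ = 3 * (‖u x‖ * N) := by simp
  rw [EuclideanSpace.norm_sq_eq]
  calc ∑ i, ‖convBase u₀ u x i‖ ^ 2 ≤ ∑ _i : Fin 3, (3 * (‖u x‖ * N)) ^ 2 :=
        Finset.sum_le_sum fun i _ => by gcongr; exact hi i
    _ = 27 * N ^ 2 * ‖u x‖ ^ 2 := by simp; ring

lemma memLp_convBase {S : Set Pt} (hS : IsOpen S) {u₀ : Pt → Pt} {N : ℝ}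
    (hu₀ : ContDiffOn ℝ 1 u₀ S) (hN : ∀ x ∈ S, ‖fderiv ℝ u₀ x‖ ≤ N) {u : Pt → Vel 𝕜}
    (hu : MemLp u 2 (volume.restrict S)) : MemLp (convBase u₀ u) 2 (volume.restrict S) := by
  have hd : ContinuousOn (fderiv ℝ u₀) S := hu₀.continuousOn_fderiv_of_isOpen hS le_rfl
  have hm : AEStronglyMeasurable (convBase u₀ u) (volume.restrict S) := by
    have hc (k i : Fin 3) : ContinuousOn (fun x => ((pderiv k u₀ x i : ℝ) : 𝕜)) S := by
      refine RCLike.continuous_ofReal.comp_continuousOn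
        ((by fun_prop : Continuous fun y : Pt => y i).comp_continuousOn ?_)
      exact hd.clm_apply continuousOn_const
    have hpi : AEStronglyMeasurable
        (fun x (i : Fin 3) => ∑ k, u x k * ((pderiv k u₀ x i : ℝ) : 𝕜)) (volume.restrict S) := by
      refine (aemeasurable_pi_lambda _ fun i => ?_).aestronglyMeasurable
      refine Finset.aemeasurable_fun_sum _ fun k _ => ?_
      exact (((by fun_prop : Continuous fun y : Vel 𝕜 => y k).comp_aestronglyMeasurable
        hu.1).mul ((hc k i).aestronglyMeasurable hS.measurableSet)).aemeasurable
    exact (PiLp.continuous_toLp 2 _).comp_aestronglyMeasurable hpi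
  refine hu.of_le_mul (c := √(27 * N ^ 2)) hm ?_
  filter_upwards [ae_restrict_mem hS.measurableSet] with x hx
  have h := Real.sqrt_le_sqrt (norm_convBase_le (u := u) (hN x hx))
  rwa [Real.sqrt_sq (norm_nonneg _), Real.sqrt_mul (by positivity),
    Real.sqrt_sq (norm_nonneg _)] at h

/-! ### The Galerkin form -/

/-- Gårding's inequality for the Galerkin form: the convective term is absorbed into the viscous
term and a multiple of `‖u‖²`. -/
lemma le_re_galerkinForm {L ν γ M N : ℝ} (hν : 0 < ν) {u₀ : Pt → Pt} (hu₀ : IsBaseFlow L u₀)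
    (hM : ∀ x ∈ openDuct L, ‖u₀ x‖ ≤ M) (hN : ∀ x ∈ openDuct L, ‖fderiv ℝ u₀ x‖ ≤ N)
    {u : Pt → Vel 𝕜} {G : Fin 3 → Pt → Vel 𝕜} (hu : MemLp u 2 (volume.restrict (openDuct L)))
    (hG : ∀ k, MemLp (G k) 2 (volume.restrict (openDuct L))) :
    3 / 4 * ν * gradNormSq (openDuct L) G
        + (γ - (3 * (M ^ 2 + 1) / ν + (27 * N ^ 2 + 1) / 2)) * normSq (openDuct L) u
      ≤ RCLike.re (galerkinForm L ν γ u₀ u G u G) := by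
  have hS := isOpen_openDuct L
  have hconv := memLp_conv hS (hu₀.continuousOn.mono (openDuct_subset_closedDuct L)) hM hG
  have hbase := memLp_convBase hS hu₀.contDiffOn hN hu
  have h1 : RCLike.re (ipGrad (openDuct L) G G) = gradNormSq (openDuct L) G := by
    simp only [ipGrad, gradNormSq, map_sum, re_ip_self (hG _)]
  -- The weight is chosen so that `a / 2 * 3 * (M ^ 2 + 1) = ν / 4`; the `+ 1` keeps it meaningful
  -- when `M = 0`.
  have h2 := neg_le_of_abs_le (abs_re_ip_le hconv hu (a := ν / (6 * (M ^ 2 + 1))) (by positivity))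
  have h3 := neg_le_of_abs_le (abs_re_ip_le hbase hu one_pos)
  have h4 := normSq_conv_le hS hM hG
  have h5 := normSq_le_of_sq_le hS.measurableSet hu
    fun x hx => norm_convBase_le (u := u) (hN x hx)
  have h6 : ν / (6 * (M ^ 2 + 1)) / 2 * normSq (openDuct L) (conv u₀ G)
      ≤ ν / 4 * gradNormSq (openDuct L) G := by
    calc _ ≤ ν / (6 * (M ^ 2 + 1)) / 2 * (3 * M ^ 2 * gradNormSq (openDuct L) G) := by gcongr
      _ ≤ ν / (6 * (M ^ 2 + 1)) / 2 * (3 * (M ^ 2 + 1) * gradNormSq (openDuct L) G) := by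
        have := gradNormSq_nonneg (openDuct L) G
        gcongr
        linarith
      _ = ν / 4 * gradNormSq (openDuct L) G := by
        field_simp
        ring
  have h7 : 1 / (2 * (ν / (6 * (M ^ 2 + 1)))) = 3 * (M ^ 2 + 1) / ν := by
    field_simp
    norm_num
  rw [h7] at h2
  simp only [galerkinForm, map_add, RCLike.re_ofReal_mul, h1, re_ip_self hu]
  linarith

end Fields

/-! ### Discrete spaces -/

section Discrete

variable {𝕜 : Type*} [RCLike 𝕜] {L : ℝ} {T : Mesh L}

/-- On each element a field of the discrete space agrees with a smooth field. -/
lemma exists_contDiff_eqOn_of_mem_pwPoly {v : Pt → Vel 𝕜} (hv : v ∈ pwPoly 𝕜 T) (e : Fin T.n) :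
    ∃ w : Pt → Vel 𝕜, ContDiff ℝ ∞ w ∧ Set.EqOn v w (T.elem e) := by
  obtain ⟨p, hp⟩ := hv.2.1 e
  refine ⟨fun x => WithLp.toLp 2 fun i => MvPolynomial.eval (fun j => ((x j : ℝ) : 𝕜)) (p i), ?_,
    fun x hx => by ext i; simpa using hp x hx i⟩
  refine (PiLp.contDiff_toLp (p := 2)).comp (contDiff_pi.2 fun i => ?_)
  induction p i using MvPolynomial.induction_on with
  | C a => simpa using contDiff_const
  | add p q hp hq => simpa using hp.add hq
  | mul_X p j hp =>
    simp only [map_mul, MvPolynomial.eval_X]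
    refine hp.mul ?_
    exact (RCLike.ofRealCLM (K := 𝕜)).contDiff.comp
      (by fun_prop : ContDiff ℝ ∞ fun x : Pt => x j)

lemma memLp_elem_of_eqOn_continuous {f g : Pt → Vel 𝕜} {e : Fin T.n} (hg : Continuous g)
    (h : Set.EqOn f g (T.elem e)) : MemLp f 2 (volume.restrict (T.elem e)) :=
  (memLp_congr_ae ((ae_restrict_mem (T.isOpen e).measurableSet).mono h)).2
    (memLp_of_continuousOn (T.subset e) (T.isOpen e) hg.continuousOn)

/-- Elements are open, so derivatives there are those of the smooth extension, which are bounded on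
the compact closed duct. -/
lemma memLp_grad_elem {v : Pt → Vel 𝕜} (hv : v ∈ pwPoly 𝕜 T) (e : Fin T.n) (k : Fin 3) :
    MemLp (grad v k) 2 (volume.restrict (T.elem e)) := by
  obtain ⟨w, hw, hvw⟩ := exists_contDiff_eqOn_of_mem_pwPoly hv e
  refine memLp_elem_of_eqOn_continuous (g := grad w k) ?_ fun x hx => ?_
  · exact (hw.continuous_fderiv (by simp)).clm_apply continuous_const
  · simp only [grad, pderiv]
    rw [(hvw.eventuallyEq_of_mem ((T.isOpen e).mem_nhds hx)).fderiv_eq]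

lemma memLp_laplacian_elem {v : Pt → Vel 𝕜} (hv : v ∈ pwPoly 𝕜 T) (e : Fin T.n) :
    MemLp (Laplacian.laplacian v) 2 (volume.restrict (T.elem e)) := by
  obtain ⟨w, hw, hvw⟩ := exists_contDiff_eqOn_of_mem_pwPoly hv e
  refine memLp_elem_of_eqOn_continuous (g := Laplacian.laplacian w) ?_ fun x hx => ?_
  · rw [InnerProductSpace.laplacian_eq_iteratedFDeriv_stdOrthonormalBasis]
    refine continuous_finsetSum _ fun i _ => ?_
    exact (continuous_eval_const _).comp (hw.continuous_iteratedFDeriv (m := 2) (WithTop.coe_le_coe.2 le_top))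
  · exact (InnerProductSpace.laplacian_congr_nhds
      (hvw.eventuallyEq_of_mem ((T.isOpen e).mem_nhds hx))).eq_of_nhds

/-- The mesh skeleton is a null set and there are finitely many elements. Hence the classical
gradient of a discrete field is square integrable, whatever value `fderiv` takes on the interfaces.
-/
lemma memLp_openDuct_of_elem {f : Pt → Vel 𝕜}
    (hf : ∀ e, MemLp f 2 (volume.restrict (T.elem e))) :
    MemLp f 2 (volume.restrict (openDuct L)) := by
  have h : volume.restrict (openDuct L) = volume.restrict (⋃ e, T.elem e) :=
    Measure.restrict_congr_set ((ae_le_set.2 T.cover).antisymm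
      (LE.le.eventuallyLE (Set.iUnion_subset T.subset)))
  have hm : AEStronglyMeasurable f (volume.restrict (⋃ e, T.elem e)) :=
    aestronglyMeasurable_iUnion_iff.2 fun e => (hf e).1
  rw [h, memLp_two_iff_integrable_sq_norm hm]
  exact integrableOn_finite_iUnion.2 fun e => (hf e).integrable_norm_pow two_ne_zero

lemma sum_normSq_elem_le {f : Pt → Vel 𝕜} (hf : MemLp f 2 (volume.restrict (openDuct L))) :
    ∑ e, normSq (T.elem e) f ≤ normSq (openDuct L) f := by
  have hi : IntegrableOn (fun x => ‖f x‖ ^ 2) (openDuct L) := hf.integrable_norm_pow two_ne_zero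
  simp only [normSq]
  rw [← integral_iUnion_fintype (fun e => (T.isOpen e).measurableSet) T.disjoint
    fun e => hi.mono_set (T.subset e)]
  exact setIntegral_mono_set hi (ae_of_all _ fun _ => by positivity)
    (LE.le.eventuallyLE (Set.iUnion_subset T.subset))

/-! ### Bounds for the stabilization parameter -/

lemma elemSpeed_nonneg (u₀ : Pt → Pt) (e : Fin T.n) : 0 ≤ elemSpeed T u₀ e := by
  refine Real.sSup_nonneg ?_
  rintro _ ⟨x, -, rfl⟩
  exact norm_nonneg _

lemma tau_nonneg {ν h : ℝ} {ζ : ℝ → ℝ} (hν : 0 < ν) (hh : 0 < h) (hζ : ∀ α : ℝ, 0 < α → 0 ≤ ζ α)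
    (u₀ : Pt → Pt) (e : Fin T.n) : 0 ≤ tau T ν h ζ u₀ e := by
  -- `ζ` is controlled only at positive arguments; at zero speed, division by zero gives `τ = 0`.
  rcases (elemSpeed_nonneg u₀ e).eq_or_lt with hs | hs
  · simp [tau, ← hs]
  · have : 0 ≤ ζ (peclet T ν h u₀ e) := hζ _ (by unfold peclet; positivity)
    unfold tau
    positivity

/-- Since `ζ(α) ≤ 4α/C²` and `α` is proportional to the element speed, the speed cancels against the
one in the denominator of `τ`. -/
lemma tau_le {ν h C : ℝ} {ζ : ℝ → ℝ} (hν : 0 < ν) (hh : 0 < h)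
    (hζ : ∀ α : ℝ, 0 < α → ζ α / α ≤ 4 / C ^ 2) (u₀ : Pt → Pt) (e : Fin T.n) :
    tau T ν h ζ u₀ e ≤ h ^ 2 / (C ^ 2 * ν) := by
  rcases (elemSpeed_nonneg u₀ e).eq_or_lt with hs | hs
  · simp only [tau, ← hs, mul_zero, div_zero, zero_mul]
    positivity
  · have hp : 0 < peclet T ν h u₀ e := by unfold peclet; positivity
    have h1 := (div_le_iff₀ hp).1 (hζ _ hp)
    calc tau T ν h ζ u₀ e ≤ h / (2 * elemSpeed T u₀ e) * (4 / C ^ 2 * peclet T ν h u₀ e) := by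
          unfold tau
          gcongr
      _ = h ^ 2 / (C ^ 2 * ν) := by
          rw [peclet, mul_comm (C ^ 2) ν]
          field_simp
          norm_num

/-- The stabilization terms are bounded below by `-(ν/2) ‖∇u‖²`, a small multiple of `‖u‖²`, and a
sixth of the streamline diffusion. -/
lemma le_re_supgForm {ν γ h C M N δ : ℝ} (hν : 0 < ν) (hh : 0 < h) (hC : 0 < C) {ζ : ℝ → ℝ}
    {u₀ : Pt → Pt} (hu₀ : IsBaseFlow L u₀)
    (hM : ∀ x ∈ openDuct L, ‖u₀ x‖ ≤ M) (hN : ∀ x ∈ openDuct L, ‖fderiv ℝ u₀ x‖ ≤ N)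
    {Vh : Submodule 𝕜 (Pt → Vel 𝕜)} (hV : Vh ≤ pwPoly 𝕜 T) (hinv : InverseEstimate T Vh h C)
    (hζ₀ : ∀ α : ℝ, 0 < α → 0 ≤ ζ α) (hζ : ∀ α : ℝ, 0 < α → ζ α / α ≤ 4 / C ^ 2) (hδ₀ : 0 ≤ δ)
    (hδ : ∀ e, tau T ν h ζ u₀ e ≤ δ) {u : Pt → Vel 𝕜} (hu : u ∈ Vh) :
    RCLike.re (galerkinForm L ν γ u₀ u (grad u) u (grad u))
        - ν / 2 * gradNormSq (openDuct L) (grad u)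
        - 3 / 2 * (27 * N ^ 2 + γ ^ 2) * δ * normSq (openDuct L) u
        + 1 / 6 * tauNormSq T (tau T ν h ζ u₀) (conv u₀ (grad u))
      ≤ RCLike.re (supgForm T ν γ u₀ (tau T ν h ζ u₀) u u) := by
  have huV := hV hu
  set τ := tau T ν h ζ u₀ with hτ
  have hτ0 (e) : 0 ≤ τ e := tau_nonneg hν hh hζ₀ u₀ e
  have hτC (e) : τ e ≤ h ^ 2 / (C ^ 2 * ν) := tau_le hν hh hζ u₀ e
  have hSu : MemLp u 2 (volume.restrict (openDuct L)) :=
    memLp_of_continuousOn subset_rfl (isOpen_openDuct L) huV.1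
  have huE (e) : MemLp u 2 (volume.restrict (T.elem e)) :=
    hSu.mono_measure (Measure.restrict_mono (T.subset e) le_rfl)
  have hconvE (e) : MemLp (conv u₀ (grad u)) 2 (volume.restrict (T.elem e)) :=
    memLp_conv (T.isOpen e)
      (hu₀.continuousOn.mono ((T.subset e).trans (openDuct_subset_closedDuct L)))
      (fun x hx => hM x (T.subset e hx)) (memLp_grad_elem huV e)
  have hbaseE (e) : MemLp (convBase u₀ u) 2 (volume.restrict (T.elem e)) :=
    memLp_convBase (T.isOpen e) (hu₀.contDiffOn.mono (T.subset e))
      (fun x hx => hN x (T.subset e hx)) (huE e)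
  have hlapE (e) := memLp_laplacian_elem huV e
  have hinv' : ∑ e, normSq (T.elem e) (Laplacian.laplacian u)
      ≤ C ^ 2 / h ^ 2 * gradNormSq (openDuct L) (grad u) := by
    have h0 : 0 ≤ ∑ e, normSq (T.elem e) (Laplacian.laplacian u) :=
      Finset.sum_nonneg fun _ _ => normSq_nonneg _ _
    have h1 := pow_le_pow_left₀ (Real.sqrt_nonneg _) (hinv u hu) 2
    rw [Real.sq_sqrt h0, mul_pow, Real.sq_sqrt (gradNormSq_nonneg _ _)] at h1
    refine h1.trans_eq ?_
    rw [mul_pow, inv_pow, div_eq_mul_inv]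
  have hlap : ν * ∑ e, τ e * RCLike.re
        (ip (T.elem e) (Laplacian.laplacian u) (conv u₀ (grad u)))
      ≤ ν / 2 * gradNormSq (openDuct L) (grad u)
        + 1 / 2 * ∑ e, τ e * normSq (T.elem e) (conv u₀ (grad u)) := by
    have h1 (e) : ν * (τ e * RCLike.re
          (ip (T.elem e) (Laplacian.laplacian u) (conv u₀ (grad u))))
        ≤ ν / 2 * (h ^ 2 / C ^ 2) * normSq (T.elem e) (Laplacian.laplacian u)
          + 1 / 2 * (τ e * normSq (T.elem e) (conv u₀ (grad u))) := by
      -- After multiplication by `ν τ`, the Young weight `ν` leaves exactly half of the streamline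
      -- term, and the coefficient `ν² τ / 2` of `‖Δu‖²` is what `tau_le` controls.
      have h2 := le_of_abs_le (abs_re_ip_le (hlapE e) (hconvE e) hν)
      have h3 := normSq_nonneg (T.elem e) (Laplacian.laplacian u)
      have h4 := mul_le_mul_of_nonneg_left h2 (mul_nonneg hν.le (hτ0 e))
      have h5 : ν ^ 2 / 2 * τ e ≤ ν / 2 * (h ^ 2 / C ^ 2) := by
        calc ν ^ 2 / 2 * τ e ≤ ν ^ 2 / 2 * (h ^ 2 / (C ^ 2 * ν)) := by
              gcongr
              exact hτC e
          _ = ν / 2 * (h ^ 2 / C ^ 2) := by field_simp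
      have h6 := mul_le_mul_of_nonneg_right h5 h3
      have h7 : ν * τ e * (ν / 2 * normSq (T.elem e) (Laplacian.laplacian u)
            + 1 / (2 * ν) * normSq (T.elem e) (conv u₀ (grad u)))
          = ν ^ 2 / 2 * τ e * normSq (T.elem e) (Laplacian.laplacian u)
            + 1 / 2 * (τ e * normSq (T.elem e) (conv u₀ (grad u))) := by
        field_simp
      linarith
    have h2 := Finset.sum_le_sum fun e (_ : e ∈ Finset.univ) => h1 e
    rw [← Finset.mul_sum, Finset.sum_add_distrib, ← Finset.mul_sum, ← Finset.mul_sum] at h2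
    have h3 : ν / 2 * (h ^ 2 / C ^ 2) * ∑ e, normSq (T.elem e) (Laplacian.laplacian u)
        ≤ ν / 2 * gradNormSq (openDuct L) (grad u) := by
      calc _ ≤ ν / 2 * (h ^ 2 / C ^ 2) * (C ^ 2 / h ^ 2 * gradNormSq (openDuct L) (grad u)) := by
            gcongr
        _ = _ := by field_simp
    linarith
  -- Common bound for the two lower order terms, `f` being `u·∇u₀` or `γu`. Young weight 3 makes
  -- each cost a sixth of the streamline term.
  have hlow {f : Pt → Vel 𝕜} {B : ℝ} (hB : 0 ≤ B)
      (hf : ∀ e, MemLp f 2 (volume.restrict (T.elem e)))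
      (hfB : ∀ e, normSq (T.elem e) f ≤ B * normSq (T.elem e) u) :
      -(3 / 2 * B * δ * normSq (openDuct L) u)
          - 1 / 6 * ∑ e, τ e * normSq (T.elem e) (conv u₀ (grad u))
        ≤ ∑ e, τ e * RCLike.re (ip (T.elem e) f (conv u₀ (grad u))) := by
    have h1 (e) : -(3 / 2 * B * δ * normSq (T.elem e) u)
          - 1 / 6 * (τ e * normSq (T.elem e) (conv u₀ (grad u)))
        ≤ τ e * RCLike.re (ip (T.elem e) f (conv u₀ (grad u))) := by
      have h2 := mul_le_mul_of_nonneg_left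
        (neg_le_of_abs_le (abs_re_ip_le (hf e) (hconvE e) (a := 3) (by norm_num))) (hτ0 e)
      have h3 : τ e * normSq (T.elem e) f ≤ δ * (B * normSq (T.elem e) u) :=
        mul_le_mul (hδ e) (hfB e) (normSq_nonneg _ _) hδ₀
      linarith
    have h2 := Finset.sum_le_sum fun e (_ : e ∈ Finset.univ) => h1 e
    rw [Finset.sum_sub_distrib, Finset.sum_neg_distrib, ← Finset.mul_sum, ← Finset.mul_sum] at h2
    have h3 : 3 / 2 * B * δ * ∑ e, normSq (T.elem e) u
        ≤ 3 / 2 * B * δ * normSq (openDuct L) u := by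
      gcongr
      exact sum_normSq_elem_le hSu
    linarith
  have hbase := hlow (B := 27 * N ^ 2) (by positivity) hbaseE fun e =>
    normSq_le_of_sq_le (T.isOpen e).measurableSet (huE e)
      fun x hx => norm_convBase_le (u := u) (hN x (T.subset e hx))
  have hγ := hlow (B := γ ^ 2) (f := fun x => (γ : 𝕜) • u x) (by positivity)
    (fun e => (huE e).const_smul (γ : 𝕜)) fun e =>
      normSq_le_of_sq_le (T.isOpen e).measurableSet (huE e) fun x _ => by
        simp [norm_smul, mul_pow]
  have hγ' (e) : ip (T.elem e) (fun x => (γ : 𝕜) • u x) (conv u₀ (grad u))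
      = (γ : 𝕜) * ip (T.elem e) u (conv u₀ (grad u)) := by
    simp only [ip, inner_smul_right, integral_const_mul]
  have hself (e) := re_ip_self (hconvE e)
  simp only [hγ', RCLike.re_ofReal_mul] at hγ
  simp only [supgForm, ipElem, tauNormSq, map_add, map_sub, map_sum, RCLike.re_ofReal_mul,
    ip_smul_right, normSq_sqrt_smul _ _ (hτ0 _), hself]
  have hcomm : ∑ e, τ e * (γ * RCLike.re (ip (T.elem e) u (conv u₀ (grad u))))
      = γ * ∑ e, τ e * RCLike.re (ip (T.elem e) u (conv u₀ (grad u))) := by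
    rw [Finset.mul_sum]
    exact Finset.sum_congr rfl fun _ _ => by ring
  rw [hcomm] at hγ
  -- Streamline budget: 1 − 1/2 (Laplacian) − 1/6 − 1/6 (lower order) = 1/6.
  linarith

end Discrete

end SUPG

/-! ### Choice of the constants -/

theorem lemmaL {𝕜 : Type*} [RCLike 𝕜] (L ν : ℝ) (hL : 0 < L) (hν : 0 < ν)
    (u₀ : SUPG.Pt → SUPG.Pt) (hu₀ : SUPG.IsBaseFlow L u₀) :
    ∃ γ₀ : ℝ, 0 < γ₀ ∧ ∀ γ : ℝ, γ₀ ≤ γ →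
      -- the shift `γ` makes the Galerkin form coercive on `V`
      (∃ α₁ : ℝ, 0 < α₁ ∧ ∀ (u : SUPG.Pt → SUPG.Vel 𝕜) (G : Fin 3 → SUPG.Pt → SUPG.Vel 𝕜),
        SUPG.MemV L u G →
          α₁ * SUPG.h1NormSq L u G ≤ RCLike.re (SUPG.galerkinForm L ν γ u₀ u G u G)) ∧
      -- and the SUPG form coercive on the discrete spaces, as soon as `τ < δ`
      ∃ δ : ℝ, 0 < δ ∧ ∃ α₀ : ℝ, 0 < α₀ ∧
        ∀ (T : SUPG.Mesh L) (Vh : Submodule 𝕜 (SUPG.Pt → SUPG.Vel 𝕜)) (h C : ℝ) (ζ : ℝ → ℝ),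
          Vh ≤ SUPG.pwPoly 𝕜 T → 0 < h → 0 < C → SUPG.InverseEstimate T Vh h C →
          (∀ α : ℝ, 0 < α → 0 ≤ ζ α) → (∀ α : ℝ, 0 < α → ζ α / α ≤ 4 / C ^ 2) →
          (∀ e, SUPG.tau T ν h ζ u₀ e < δ) →
          ∀ u ∈ Vh,
            α₀ * SUPG.h1NormSq L u (SUPG.grad u)
                + 1 / 6 * SUPG.tauNormSq T (SUPG.tau T ν h ζ u₀)
                    (SUPG.conv u₀ (SUPG.grad u))
              ≤ RCLike.re (SUPG.supgForm T ν γ u₀ (SUPG.tau T ν h ζ u₀) u u) := by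
  obtain ⟨M, hM⟩ := (SUPG.isCompact_closedDuct L).exists_bound_of_continuousOn hu₀.continuousOn
  replace hM : ∀ x ∈ SUPG.openDuct L, ‖u₀ x‖ ≤ M :=
    fun x hx => hM x (SUPG.openDuct_subset_closedDuct L hx)
  obtain ⟨N, hN⟩ := hu₀.grad_bounded
  set K : ℝ := 3 * (M ^ 2 + 1) / ν + (27 * N ^ 2 + 1) / 2 with hK
  have hK0 : 0 ≤ K := by positivity
  -- `K` is the loss in `le_re_galerkinForm`. Of the margin 2, one unit pays for the lower order
  -- stabilization terms, which `δ` keeps below `‖u‖²`, and one is left for coercivity. The gradient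
  -- coefficient `ν / 4` is 3ν/4 from the Galerkin form minus ν/2 from the Laplacian term.
  refine ⟨K + 2, by linarith, fun γ hγ => ⟨⟨min (3 / 4 * ν) 1, by positivity, ?_⟩,
    1 / (3 / 2 * (27 * N ^ 2 + γ ^ 2 + 1)), by positivity, min (ν / 4) 1, by positivity, ?_⟩⟩
  · rintro u G ⟨hu, hG, -⟩
    refine le_trans ?_ (SUPG.le_re_galerkinForm hν hu₀ hM hN hu hG)
    rw [SUPG.h1NormSq, mul_add, add_comm]
    have h1 := SUPG.normSq_nonneg (SUPG.openDuct L) u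
    have h2 := SUPG.gradNormSq_nonneg (SUPG.openDuct L) G
    refine add_le_add ?_ ?_
    · exact mul_le_mul_of_nonneg_right (min_le_left _ _) h2
    · exact mul_le_mul_of_nonneg_right ((min_le_right _ _).trans (by linarith)) h1
  · intro T Vh h C ζ hV hh hC hinv hζ₀ hζ hδ u hu
    set δ : ℝ := 1 / (3 / 2 * (27 * N ^ 2 + γ ^ 2 + 1)) with hδ_def
    have hδ0 : 0 < δ := by positivity
    have huL : MeasureTheory.MemLp u 2 (MeasureTheory.volume.restrict (SUPG.openDuct L)) :=
      SUPG.memLp_of_continuousOn subset_rfl (SUPG.isOpen_openDuct L) (hV hu).1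
    have hGL (k) : MeasureTheory.MemLp (SUPG.grad u k) 2
        (MeasureTheory.volume.restrict (SUPG.openDuct L)) :=
      SUPG.memLp_openDuct_of_elem fun e => SUPG.memLp_grad_elem (hV hu) e k
    have hgal := SUPG.le_re_galerkinForm (γ := γ) hν hu₀ hM hN huL hGL
    have hsupg := SUPG.le_re_supgForm (γ := γ) hν hh hC hu₀ hM hN hV hinv hζ₀ hζ hδ0.le
      (fun e => (hδ e).le) hu
    rw [← hK] at hgal
    have h1 := SUPG.normSq_nonneg (SUPG.openDuct L) u
    have h2 := SUPG.gradNormSq_nonneg (SUPG.openDuct L) (SUPG.grad u)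
    have h3 : 3 / 2 * (27 * N ^ 2 + γ ^ 2) * δ ≤ 1 := by
      rw [hδ_def, mul_one_div, div_le_one (by positivity)]
      linarith
    have h4 := mul_le_mul_of_nonneg_right h3 h1
    have h5 := mul_le_mul_of_nonneg_right (min_le_left (ν / 4) 1) h2
    have h6 := mul_le_mul_of_nonneg_right (min_le_right (ν / 4) 1) h1
    have h7 := mul_le_mul_of_nonneg_right (by linarith : 2 ≤ γ - K) h1
    rw [SUPG.h1NormSq, mul_add]
    linarith
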